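/- For $N\ge 1$ let $x_1,\dots,x_N,y_1,\dots,y_N$ be independent and uniformly distributed on $[0,1]$, each family being relabelled in increasing order, $x_1<\dots<x_N$ and $y_1<\dots<y_N$ (almost surely). For $p>1$ put $$\varepsilon_N^{(p)}:=\mathbb E\Big[\min_{\pi\in S_N}\varepsilon_N^{(p)}(\pi)\Big],\qquad \varepsilon_N^{(p)}(\pi):=\frac1N\sum_{i=1}^N|x_i-y_{\pi(i)}|^p ,$$ and let $\phi_N(s):=\sqrt N\,(y_k-x_k)$ for $s\in[\frac{k-1}{N},\frac kN)$, $k=1,\dots,N$. Then: 1. For every $p>1$ and all points $x_1<\dots<x_N$, $y_1<\dots<y_N$ in $[0,1]$, the identity is the unique minimizer of $\pi\mapsto\varepsilon_N^{(p)}(\pi)$. 2. For every $p>1$ and $N\ge1$ the minimal cost is an integrable random variable and $$N^{p/2}\varepsilon_N^{(p)}=\int_0^1\mathbb E\,|\phi_N(s)|^p\,ds,$$ and, for every fixed $p>1$, as $N\to\infty$, $$N^{p/2}\varepsilon_N^{(p)}=\frac{\Gamma(1+p/2)}{p+1}\Big(1-\frac{p(p+2)}{8N}\Big)+o\Big(\frac1N\Big).$$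 3. For $1\le k\le N$, the law of $y_k-x_k$ is that of $Y-X$ with $X,Y$ independent and both distributed as $\mathrm{Beta}(k,N-k+1)$. 4. For $p=2$ and every $N\ge1$, $\varepsilon_N^{(2)}=\dfrac1{3(N+1)}$. -/

import Mathlib

open MeasureTheory ProbabilityTheory Filter Asymptotics

noncomputable section

namespace RandomAssignment

/-- The increasing relabelling of a finite family of points:
`ordered x k` is the `(k+1)`-st smallest of the points `x i`, `i : Fin N`. -/
def ordered {N : ℕ} (x : Fin N → ℝ) : Fin N → ℝ := x ∘ Tuple.sort x

/-- The law of a pair `(x, y)` of families of `N` points each, all `2 N` points being independent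
and uniformly distributed on the unit interval. -/
def pointsLaw (N : ℕ) : Measure ((Fin N → ℝ) × (Fin N → ℝ)) :=
  (Measure.pi fun _ : Fin N => (volume : Measure ℝ).restrict (Set.Icc 0 1)).prod
    (Measure.pi fun _ : Fin N => (volume : Measure ℝ).restrict (Set.Icc 0 1))

/-- The mean cost per edge of the matching `x i ↦ y (π i)` with edge cost `z ^ p`. -/
def meanCost (p : ℝ) {N : ℕ} (x y : Fin N → ℝ) (π : Equiv.Perm (Fin N)) : ℝ :=
  (1 / (N : ℝ)) * ∑ i, |x i - y (π i)| ^ p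

/-- The minimum over all matchings of the mean cost per edge
(the infimum is over a finite nonempty type, hence a minimum). -/
def optMeanCost (p : ℝ) {N : ℕ} (x y : Fin N → ℝ) : ℝ :=
  ⨅ π : Equiv.Perm (Fin N), meanCost p x y π

/-- The average optimal mean cost of the random assignment problem on the unit interval. -/
def avgOptCost (p : ℝ) (N : ℕ) : ℝ :=
  ∫ z, optMeanCost p (ordered z.1) (ordered z.2) ∂(pointsLaw N)

/-- The rescaled displacement field `φ(s) = √N (y_k - x_k)` of the ordered points, for
`s ∈ [(k-1)/N, k/N)`, `k = 1, …, N` (cells centred at `(k - 1/2)/N`; here `k - 1 = ⌊N s⌋`). -/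
def displacement {N : ℕ} (x y : Fin N → ℝ) (s : ℝ) : ℝ :=
  if h : ⌊(N : ℝ) * s⌋₊ < N then
    √(N : ℝ) * (ordered y ⟨⌊(N : ℝ) * s⌋₊, h⟩ - ordered x ⟨⌊(N : ℝ) * s⌋₊, h⟩)
  else 0

end RandomAssignment

end

/-! Strict convexity of `|t| ^ p` makes uncrossing two edges profitable, so the increasing matching
is optimal and the mean cost is the average over k of `|y_k - x_k| ^ p` (`meanCost_id_lt`,
`optMeanCost_ordered`). The distribution function of an order statistic is a binomial tail whose
derivative telescopes to a Beta density (`map_ordered_uniformLaw`); independence of the two samples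
gives the law of the difference.

The expansion follows from a closed form valid for every N ≥ 1, `avgOptCost_eq`: the average cost is
Γ(1+p/2)/(p+1) · Γ(N+1)/Γ(N+1+p/2). With n = N - 1, the products of the two Beta densities of equal
rank are summed over the ranks before integrating. Along a line y - x = h that sum integrates, up to
the factor (n+1)², to ∫_h^1 (1-τ²)^n dτ (`integral_pairDensity`); integrating against h^p leaves a
Beta integral.

For p = 2 the Gamma quotient is 1/(N+1). In general N^a Γ(N+1)/Γ(N+1+a) = 1 - a(a+1)/(2N) + o(1/N)
(`tendsto_mul_gammaRatio_sub_one`), and a = p/2 gives the constant p(p+2)/8. -/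

namespace RandomAssignment

/-! ### Optimality of the increasing matching -/

lemma strictConvexOn_abs_rpow {p : ℝ} (hp : 1 < p) :
    StrictConvexOn ℝ Set.univ (fun t : ℝ => |t| ^ p) := by
  have hp0 : 0 < p := by linarith
  refine ⟨convex_univ, fun u _ v _ huv a b ha hb hab => ?_⟩
  simp only [smul_eq_mul]
  have htri : |a * u + b * v| ≤ a * |u| + b * |v| := by
    calc |a * u + b * v| ≤ |a * u| + |b * v| := abs_add_le _ _
      _ = a * |u| + b * |v| := by rw [abs_mul, abs_mul, abs_of_pos ha, abs_of_pos hb]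
  -- Strictness has two sources: if |u| = |v| then u = -v and the triangle inequality is strict;
  -- otherwise the power function is strictly convex on the half-line.
  rcases eq_or_ne |u| |v| with h | h
  · have huv' : u = -v := (abs_eq_abs.1 h).resolve_left huv
    have hv : 0 < |v| := by
      rw [abs_pos]
      rintro rfl
      simp at huv'
      exact huv huv'
    have hlt : |a * u + b * v| < |v| := by
      have : a * u + b * v = (b - a) * v := by rw [huv']; ring
      rw [this, abs_mul]
      have : |b - a| < 1 := by rw [abs_lt]; constructor <;> linarith
      nlinarith
    calc |a * u + b * v| ^ p < |v| ^ p := Real.rpow_lt_rpow (abs_nonneg _) hlt hp0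
      _ = a * |u| ^ p + b * |v| ^ p := by rw [h, ← add_mul, hab, one_mul]
  · calc |a * u + b * v| ^ p ≤ (a * |u| + b * |v|) ^ p :=
          Real.rpow_le_rpow (abs_nonneg _) htri hp0.le
      _ < a * |u| ^ p + b * |v| ^ p :=
          (strictConvexOn_rpow hp).2 (abs_nonneg u) (abs_nonneg v) h ha hb hab

/-- Uncrossing two edges strictly lowers a strictly convex cost. -/
lemma cost_uncross_lt {f : ℝ → ℝ} (hf : StrictConvexOn ℝ Set.univ f) {x₁ x₂ y₁ y₂ : ℝ}
    (hx : x₁ < x₂) (hy : y₁ < y₂) :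
    f (x₁ - y₁) + f (x₂ - y₂) < f (x₁ - y₂) + f (x₂ - y₁) := by
  have hd : 0 < (x₂ - x₁) + (y₂ - y₁) := by linarith
  -- d is the gap between the crossed differences x₁ - y₂ and x₂ - y₁. The uncrossed ones are convex
  -- combinations of these two with exchanged weights, so the two convexity inequalities add up to
  -- the claim.
  set d := (x₂ - x₁) + (y₂ - y₁) with hd_def
  have ha : 0 < (x₂ - x₁) / d := div_pos (by linarith) hd
  have hb : 0 < (y₂ - y₁) / d := div_pos (by linarith) hd
  have hab : (x₂ - x₁) / d + (y₂ - y₁) / d = 1 := by rw [← add_div, div_self hd.ne']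
  have hne : x₁ - y₂ ≠ x₂ - y₁ := by intro h; linarith
  have h1 := hf.2 (Set.mem_univ _) (Set.mem_univ _) hne ha hb hab
  have h2 := hf.2 (Set.mem_univ _) (Set.mem_univ _) hne hb ha (by rw [add_comm, hab])
  simp only [smul_eq_mul] at h1 h2
  have e1 : (x₂ - x₁) / d * (x₁ - y₂) + (y₂ - y₁) / d * (x₂ - y₁) = x₁ - y₁ := by
    field_simp
    rw [hd_def]; ring
  have e2 : (y₂ - y₁) / d * (x₁ - y₂) + (x₂ - x₁) / d * (x₂ - y₁) = x₂ - y₂ := by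
    field_simp
    rw [hd_def]; ring
  rw [e1] at h1
  rw [e2] at h2
  have e3 : (y₂ - y₁) / d = 1 - (x₂ - x₁) / d := by linarith
  rw [e3] at h1 h2
  linarith

lemma exists_inversion {N : ℕ} {π : Equiv.Perm (Fin N)} (hπ : π ≠ 1) :
    ∃ i j, i < j ∧ π j < π i := by
  by_contra! h
  have hmono : StrictMono π := fun i j hij => (h i j hij).lt_of_ne (π.injective.ne hij.ne)
  apply hπ
  ext i
  have := congrArg (fun e : Fin N ≃o Fin N => e i)
    (Subsingleton.elim (hmono.orderIsoOfSurjective _ π.surjective) (OrderIso.refl _))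
  simpa using congrArg Fin.val this

lemma meanCost_id_lt {p : ℝ} (hp : 1 < p) {N : ℕ} {x y : Fin N → ℝ} (hx : StrictMono x)
    (hy : StrictMono y) {π : Equiv.Perm (Fin N)} (hπ : π ≠ 1) :
    meanCost p x y 1 < meanCost p x y π := by
  have key : ∀ π : Equiv.Perm (Fin N), π ≠ 1 → ∃ σ, meanCost p x y σ < meanCost p x y π := by
    intro π hπ
    obtain ⟨i, j, hij, hji⟩ := exists_inversion hπ
    refine ⟨π * Equiv.swap i j, ?_⟩
    have hN : 0 < (N : ℝ) := by exact_mod_cast (Fin.pos i)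
    unfold meanCost
    refine mul_lt_mul_of_pos_left ?_ (by positivity)
    have hmem : j ∈ Finset.univ.erase i := by simp [hij.ne']
    rw [← Finset.add_sum_erase _ _ (Finset.mem_univ i), ← Finset.add_sum_erase _ _ hmem,
      ← Finset.add_sum_erase Finset.univ (fun i => |x i - y (π i)| ^ p) (Finset.mem_univ i),
      ← Finset.add_sum_erase _ (fun i => |x i - y (π i)| ^ p) hmem]
    have hrest : ∀ k ∈ (Finset.univ.erase i).erase j,
        |x k - y ((π * Equiv.swap i j) k)| ^ p = |x k - y (π k)| ^ p := by
      intro k hk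
      simp only [Finset.mem_erase, Finset.mem_univ, and_true] at hk
      rw [Equiv.Perm.mul_apply, Equiv.swap_apply_of_ne_of_ne hk.2 hk.1]
    rw [Finset.sum_congr rfl hrest]
    have := cost_uncross_lt (strictConvexOn_abs_rpow hp) (hx hij) (hy hji)
    simp only [Equiv.Perm.mul_apply, Equiv.swap_apply_left, Equiv.swap_apply_right]
    linarith
  -- A minimizer exists by finiteness, and only the identity cannot be improved by uncrossing.
  obtain ⟨σ, hσ⟩ := Finite.exists_min (fun π : Equiv.Perm (Fin N) => meanCost p x y π)
  have hσ1 : σ = 1 := by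
    by_contra h
    obtain ⟨τ, hτ⟩ := key σ h
    exact (hσ τ).not_gt hτ
  subst hσ1
  obtain ⟨τ, hτ⟩ := key π hπ
  exact (hσ τ).trans_lt hτ

/-- Ties are removed by adding ε·i to the i-th point of both families, then ε → 0. This makes the
cost formula hold at every configuration, not merely almost surely. -/
lemma meanCost_id_le {p : ℝ} (hp : 1 < p) {N : ℕ} {x y : Fin N → ℝ} (hx : Monotone x)
    (hy : Monotone y) (π : Equiv.Perm (Fin N)) :
    meanCost p x y 1 ≤ meanCost p x y π := by
  rcases eq_or_ne π 1 with rfl | hπ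
  · exact le_rfl
  have hp0 : 0 ≤ p := by linarith
  let u : ℝ → Fin N → ℝ := fun ε i => x i + ε * (i : ℕ)
  let v : ℝ → Fin N → ℝ := fun ε i => y i + ε * (i : ℕ)
  have hcont : ∀ σ, Continuous fun ε => meanCost p (u ε) (v ε) σ := by
    intro σ
    unfold meanCost
    refine continuous_const.mul (continuous_finsetSum _ fun i _ => ?_)
    exact Continuous.rpow_const (by fun_prop) fun _ => Or.inr hp0
  have hlim : ∀ σ, Tendsto (fun ε => meanCost p (u ε) (v ε) σ) (nhdsWithin 0 (Set.Ioi 0))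
      (nhds (meanCost p x y σ)) := by
    intro σ
    have h := ((hcont σ).tendsto 0).mono_left (nhdsWithin_le_nhds (s := Set.Ioi 0))
    simpa [u, v] using h
  refine le_of_tendsto_of_tendsto (hlim 1) (hlim π) ?_
  filter_upwards [self_mem_nhdsWithin] with ε (hε : 0 < ε)
  have hstrict : ∀ {w : Fin N → ℝ}, Monotone w → StrictMono fun i => w i + ε * ((i : ℕ) : ℝ) := by
    intro w hw i j hij
    have h1 := hw hij.le
    have h2 : ((i : ℕ) : ℝ) < (j : ℕ) := by exact_mod_cast hij
    have := mul_lt_mul_of_pos_left h2 hε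
    simp only
    linarith
  exact (meanCost_id_lt hp (hstrict hx) (hstrict hy) hπ).le

lemma ordered_monotone {N : ℕ} (x : Fin N → ℝ) : Monotone (ordered x) := Tuple.monotone_sort x

/-- The minimal mean cost is attained by the increasing matching. -/
lemma optMeanCost_ordered {p : ℝ} (hp : 1 < p) {N : ℕ} (x y : Fin N → ℝ) :
    optMeanCost p (ordered x) (ordered y) =
      1 / (N : ℝ) * ∑ i, |ordered y i - ordered x i| ^ p := by
  have h : optMeanCost p (ordered x) (ordered y) = meanCost p (ordered x) (ordered y) 1 :=
    le_antisymm (ciInf_le (Set.finite_range _).bddBelow 1)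
      (le_ciInf fun π => meanCost_id_le hp (ordered_monotone x) (ordered_monotone y) π)
  rw [h]
  simp [meanCost, abs_sub_comm]

/-! ### Order statistics and Beta laws -/

/-- The uniform law of `N` independent points of the unit interval. -/
noncomputable def uniformLaw (N : ℕ) : Measure (Fin N → ℝ) :=
  Measure.pi fun _ : Fin N => (volume : Measure ℝ).restrict (Set.Icc 0 1)

instance isProbabilityMeasure_unitInterval :
    IsProbabilityMeasure ((volume : Measure ℝ).restrict (Set.Icc 0 1)) :=
  ⟨by simp⟩

instance isProbabilityMeasure_uniformLaw (N : ℕ) : IsProbabilityMeasure (uniformLaw N) := by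
  unfold uniformLaw; infer_instance

lemma pointsLaw_eq (N : ℕ) : pointsLaw N = (uniformLaw N).prod (uniformLaw N) := rfl

instance isProbabilityMeasure_pointsLaw (N : ℕ) : IsProbabilityMeasure (pointsLaw N) := by
  rw [pointsLaw_eq]; infer_instance

/-- The configurations whose points in `(-∞, t]` are exactly those with index in `S`. -/
def cell {N : ℕ} (t : ℝ) (S : Finset (Fin N)) : Set (Fin N → ℝ) :=
  Set.univ.pi fun i => if i ∈ S then Set.Iic t else Set.Ioi t

lemma mem_cell {N : ℕ} {t : ℝ} {S : Finset (Fin N)} {x : Fin N → ℝ} :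
    x ∈ cell t S ↔ Finset.univ.filter (fun i => x i ≤ t) = S := by
  simp only [cell, Set.mem_pi, Set.mem_univ, true_imp_iff, Finset.ext_iff, Finset.mem_filter,
    Finset.mem_univ, true_and]
  refine forall_congr' fun i => ?_
  by_cases h : i ∈ S <;> simp [h]

lemma measurableSet_cell {N : ℕ} (t : ℝ) (S : Finset (Fin N)) : MeasurableSet (cell t S) := by
  refine MeasurableSet.univ_pi fun i => ?_
  split_ifs
  exacts [measurableSet_Iic, measurableSet_Ioi]

lemma ordered_le_iff {N : ℕ} (x : Fin N → ℝ) (k : Fin N) (t : ℝ) :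
    ordered x k ≤ t ↔ (k : ℕ) < (Finset.univ.filter (fun i => x i ≤ t)).card := by
  rw [← Tuple.lt_card_le_iff_apply_le_of_monotone (ordered_monotone x)]
  have : (Finset.univ.filter (fun i => ordered x i ≤ t)).card =
      (Finset.univ.filter (fun i => x i ≤ t)).card := by
    refine Finset.card_bij (fun i _ => Tuple.sort x i) ?_ ?_ ?_
    · intro i hi
      rw [Finset.mem_filter_univ] at hi ⊢
      exact hi
    · intro i _ j _ h
      exact (Tuple.sort x).injective h
    · intro j hj
      refine ⟨(Tuple.sort x).symm j, ?_, by simp⟩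
      rw [Finset.mem_filter_univ] at hj ⊢
      simpa [ordered] using hj
  rw [← this]

/-- The cells are disjoint for distinct `S` and have product form, so their measures can be computed
and added. With ranks counted from 0, more than k points must lie below t. -/
lemma ordered_preimage_Iic {N : ℕ} (k : Fin N) (t : ℝ) :
    (fun x : Fin N → ℝ => ordered x k) ⁻¹' Set.Iic t =
      ⋃ S ∈ Finset.univ.filter (fun S : Finset (Fin N) => (k : ℕ) < S.card), cell t S := by
  ext x
  simp only [Set.mem_preimage, Set.mem_Iic, ordered_le_iff, Set.mem_iUnion, mem_cell,
    Finset.mem_filter, Finset.mem_univ, true_and, exists_prop]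
  exact ⟨fun h => ⟨_, h, rfl⟩, fun ⟨S, h, hS⟩ => hS ▸ h⟩

lemma measurable_ordered {N : ℕ} (k : Fin N) : Measurable fun x : Fin N → ℝ => ordered x k := by
  refine measurable_of_Iic fun t => ?_
  rw [ordered_preimage_Iic]
  exact Finset.measurableSet_biUnion _ fun S _ => measurableSet_cell t S

lemma unitInterval_Iic (t : ℝ) :
    ((volume : Measure ℝ).restrict (Set.Icc 0 1)) (Set.Iic t) =
      ENNReal.ofReal (max 0 (min t 1)) := by
  have h : Set.Iic t ∩ Set.Icc 0 1 = Set.Icc 0 (min t 1) := by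
    ext x
    simp only [Set.mem_inter_iff, Set.mem_Iic, Set.mem_Icc, le_min_iff]
    tauto
  rw [Measure.restrict_apply measurableSet_Iic, h, Real.volume_Icc, sub_zero, ENNReal.ofReal_max]
  simp

lemma uniformLaw_real_cell {N : ℕ} (t : ℝ) (S : Finset (Fin N)) :
    (uniformLaw N).real (cell t S) =
      (max 0 (min t 1)) ^ S.card * (1 - max 0 (min t 1)) ^ (N - S.card) := by
  set τ := max 0 (min t 1) with hτ
  have h0 : 0 ≤ τ := le_max_left _ _
  have h1 : ((volume : Measure ℝ).restrict (Set.Icc 0 1)).real (Set.Iic t) = τ := by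
    rw [measureReal_def, unitInterval_Iic, ENNReal.toReal_ofReal h0]
  have h2 : ((volume : Measure ℝ).restrict (Set.Icc 0 1)).real (Set.Ioi t) = 1 - τ := by
    rw [← Set.compl_Iic, probReal_compl_eq_one_sub measurableSet_Iic, h1]
  have : (uniformLaw N).real (cell t S) = ∏ i : Fin N, if i ∈ S then τ else 1 - τ := by
    rw [measureReal_def, uniformLaw, cell, Measure.pi_pi, ENNReal.toReal_prod]
    refine Finset.prod_congr rfl fun i _ => ?_
    split_ifs
    exacts [h1, h2]
  rw [this, Finset.prod_ite, Finset.prod_const, Finset.prod_const]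
  congr 2
  · simp
  · rw [Finset.filter_not, Finset.card_sdiff_of_subset (Finset.filter_subset _ _)]
    simp

/-- The distribution function of an order statistic of the uniform law is a binomial tail. -/
lemma uniformLaw_real_ordered_le {n : ℕ} (k : Fin (n + 1)) (t : ℝ) :
    (uniformLaw (n + 1)).real ((fun x => ordered x k) ⁻¹' Set.Iic t) =
      ∑ m ∈ Finset.Ico (k + 1 : ℕ) (n + 2),
        (bernsteinPolynomial ℝ (n + 1) m).eval (max 0 (min t 1)) := by
  rw [ordered_preimage_Iic, measureReal_biUnion_finset]
  · simp_rw [uniformLaw_real_cell]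
    set τ := max 0 (min t 1)
    rw [Finset.sum_filter, ← Finset.powerset_univ]
    have := Finset.sum_powerset_apply_card
      (fun m => if (k : ℕ) < m then τ ^ m * (1 - τ) ^ (n + 1 - m) else 0)
      (x := (Finset.univ : Finset (Fin (n + 1))))
    rw [this, Finset.card_univ, Fintype.card_fin]
    have hsub : Finset.Ico (k + 1 : ℕ) (n + 2) ⊆ Finset.range (n + 2) := by
      intro m hm
      simp only [Finset.mem_Ico, Finset.mem_range] at *
      exact hm.2
    rw [← Finset.sum_subset hsub]
    · refine Finset.sum_congr rfl fun m hm => ?_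
      have : (k : ℕ) < m := (Finset.mem_Ico.1 hm).1
      simp [this, bernsteinPolynomial, mul_assoc]
    · intro m hm hm'
      have : ¬ (k : ℕ) < m := by
        simp only [Finset.mem_Ico, Finset.mem_range] at *
        omega
      simp [this]
  · intro S _ T _ hST
    refine Set.disjoint_left.2 fun x hS hT => hST ?_
    rw [mem_cell] at hS hT
    exact hS.symm.trans hT
  · exact fun S _ => measurableSet_cell t S

/-- The density on the unit interval of the order statistic of rank `k + 1` of `n + 1` points. -/
noncomputable def orderDensity (n k : ℕ) (x : ℝ) : ℝ :=
  (n + 1) * (n.choose k * x ^ k * (1 - x) ^ (n - k))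

lemma continuous_orderDensity (n k : ℕ) : Continuous (orderDensity n k) := by
  unfold orderDensity; fun_prop

lemma orderDensity_nonneg (n k : ℕ) {x : ℝ} (h0 : 0 ≤ x) (h1 : x ≤ 1) :
    0 ≤ orderDensity n k x := by
  have : 0 ≤ 1 - x := by linarith
  unfold orderDensity
  positivity

lemma hasDerivAt_binomialTail (n k : ℕ) (hk : k ≤ n) (t : ℝ) :
    HasDerivAt (fun t => ∑ m ∈ Finset.Ico (k + 1) (n + 2), (bernsteinPolynomial ℝ (n + 1) m).eval t)
      (orderDensity n k t) t := by
  have h := HasDerivAt.fun_sum (u := Finset.Ico (k + 1) (n + 2)) (x := t)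
    fun m _ => (bernsteinPolynomial ℝ (n + 1) m).hasDerivAt t
  refine h.congr_deriv ?_
  -- The derivative of a Bernstein polynomial is a difference of two neighbours of degree n, so the
  -- sum telescopes; the upper end has index n + 1 and vanishes.
  rw [← Finset.sum_Ico_add' _ k (n + 1) 1]
  have : ∀ m ∈ Finset.Ico k (n + 1),
      (Polynomial.derivative (bernsteinPolynomial ℝ (n + 1) (m + 1))).eval t =
        (n + 1) * (bernsteinPolynomial ℝ n m).eval t -
          (n + 1) * (bernsteinPolynomial ℝ n (m + 1)).eval t := by
    intro m _
    rw [bernsteinPolynomial.derivative_succ]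
    simp
    ring
  rw [Finset.sum_congr rfl this]
  have htel := Finset.sum_range_sub'
    (fun m => ((n : ℝ) + 1) * (bernsteinPolynomial ℝ n (k + m)).eval t) (n + 1 - k)
  rw [Finset.sum_Ico_eq_sum_range]
  simp only [← add_assoc] at htel
  rw [htel, Nat.add_sub_cancel' (by omega : k ≤ n + 1), bernsteinPolynomial.eq_zero_of_lt ℝ (Nat.lt_succ_self n)]
  simp [orderDensity, bernsteinPolynomial]

lemma beta_natCast (n k : ℕ) (hk : k ≤ n) :
    1 / beta ((k : ℝ) + 1) (((n + 1 : ℕ) : ℝ) - k) = (n + 1) * n.choose k := by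
  have h1 : ((n + 1 : ℕ) : ℝ) - k = ((n - k : ℕ) : ℝ) + 1 := by
    rw [Nat.cast_sub hk]; push_cast; ring
  have h2 : (k : ℝ) + 1 + (((n - k : ℕ) : ℝ) + 1) = ((n + 1 : ℕ) : ℝ) + 1 := by
    rw [Nat.cast_sub hk]; push_cast; ring
  rw [beta, h1, h2, Real.Gamma_nat_eq_factorial, Real.Gamma_nat_eq_factorial,
    Real.Gamma_nat_eq_factorial, one_div_div, Nat.factorial_succ, Nat.cast_choose ℝ hk]
  push_cast
  ring

lemma betaMeasure_eq_withDensity (n k : ℕ) (hk : k ≤ n) :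
    betaMeasure ((k : ℝ) + 1) (((n + 1 : ℕ) : ℝ) - k) =
      ((volume : Measure ℝ).restrict (Set.Ioc 0 1)).withDensity
        (fun x => ENNReal.ofReal (orderDensity n k x)) := by
  -- The half-open interval is chosen to match interval integrals; the endpoint is null.
  rw [Measure.restrict_congr_set (Ioo_ae_eq_Ioc (a := (0 : ℝ)) (b := 1)).symm,
    ← withDensity_indicator measurableSet_Ioo, betaMeasure]
  congr 1
  ext x
  by_cases hx : x ∈ Set.Ioo (0 : ℝ) 1
  · rw [Set.indicator_of_mem hx, betaPDF_of_pos_lt_one hx.1 hx.2, beta_natCast n k hk]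
    have h1 : ((n + 1 : ℕ) : ℝ) - k - 1 = ((n - k : ℕ) : ℝ) := by
      rw [Nat.cast_sub hk]; push_cast; ring
    rw [h1, add_sub_cancel_right, Real.rpow_natCast, Real.rpow_natCast, orderDensity]
    congr 1
    ring
  · rw [Set.indicator_of_notMem hx]
    rcases le_or_gt x 0 with h | h
    · exact betaPDF_eq_zero_of_nonpos h
    · exact betaPDF_eq_zero_of_one_le (not_lt.1 fun h' => hx ⟨h, h'⟩)

/-- The order statistics of independent uniform points are Beta distributed. -/
lemma map_ordered_uniformLaw {N : ℕ} (k : Fin N) :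
    (uniformLaw N).map (fun x => ordered x k) = betaMeasure ((k : ℝ) + 1) ((N : ℝ) - k) := by
  obtain ⟨n, rfl⟩ : ∃ n, N = n + 1 := Nat.exists_eq_succ_of_ne_zero (Fin.pos k).ne'
  have hk : (k : ℕ) ≤ n := Nat.lt_succ_iff.1 k.2
  have hkn : ((k : ℕ) : ℝ) < ((n + 1 : ℕ) : ℝ) := by exact_mod_cast k.2
  have := isProbabilityMeasureBeta (α := (k : ℝ) + 1) (β := ((n + 1 : ℕ) : ℝ) - k)
    (by positivity) (by linarith)
  have := Measure.isProbabilityMeasure_map (μ := uniformLaw (n + 1))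
    (measurable_ordered k).aemeasurable
  refine Measure.ext_of_Iic _ _ fun t => ?_
  rw [Measure.map_apply (measurable_ordered k) measurableSet_Iic]
  refine (measureReal_eq_measureReal_iff (measure_ne_top _ _) (measure_ne_top _ _)).1 ?_
  rw [uniformLaw_real_ordered_le]
  set τ := max 0 (min t 1) with hτ
  have h0 : 0 ≤ τ := le_max_left _ _
  have h1 : τ ≤ 1 := max_le zero_le_one (min_le_right _ _)
  have hset : Set.Iic t ∩ Set.Ioc 0 1 = Set.Ioc 0 τ := by
    ext x
    simp only [Set.mem_inter_iff, Set.mem_Iic, Set.mem_Ioc, hτ, le_max_iff, le_min_iff]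
    constructor
    · rintro ⟨h, h', h''⟩; exact ⟨h', Or.inr ⟨h, h''⟩⟩
    · rintro ⟨h, h' | h'⟩
      · linarith
      · exact ⟨h'.1, h, h'.2⟩
  have hFTC := intervalIntegral.integral_eq_sub_of_hasDerivAt (a := 0) (b := τ)
    (fun t _ => hasDerivAt_binomialTail n k hk t)
    ((continuous_orderDensity n k).intervalIntegrable _ _)
  have hzero : ∑ m ∈ Finset.Ico (k + 1 : ℕ) (n + 2),
      (bernsteinPolynomial ℝ (n + 1) m).eval 0 = 0 := by
    refine Finset.sum_eq_zero fun m hm => ?_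
    have : m ≠ 0 := by have := (Finset.mem_Ico.1 hm).1; omega
    simp [bernsteinPolynomial, this]
  rw [hzero, sub_zero] at hFTC
  rw [← hFTC, betaMeasure_eq_withDensity n k hk, measureReal_def,
    withDensity_apply _ measurableSet_Iic, Measure.restrict_restrict measurableSet_Iic, hset,
    intervalIntegral.integral_of_le h0, integral_eq_lintegral_of_nonneg_ae]
  · refine ae_restrict_of_forall_mem measurableSet_Ioc fun x hx => ?_
    exact orderDensity_nonneg n k hx.1.le (hx.2.trans h1)
  · exact (continuous_orderDensity n k).aestronglyMeasurable

lemma map_ordered_pointsLaw {N : ℕ} (k : Fin N) :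
    (pointsLaw N).map (fun z => (ordered z.1 k, ordered z.2 k)) =
      (betaMeasure ((k : ℝ) + 1) ((N : ℝ) - k)).prod
        (betaMeasure ((k : ℝ) + 1) ((N : ℝ) - k)) := by
  rw [← map_ordered_uniformLaw k, pointsLaw_eq,
    Measure.map_prod_map _ _ (measurable_ordered k) (measurable_ordered k)]
  rfl

lemma map_ordered_sub_pointsLaw (N : ℕ) (k : Fin N) :
    (pointsLaw N).map (fun z => ordered z.2 k - ordered z.1 k) =
      ((betaMeasure ((k : ℝ) + 1) ((N : ℝ) - k)).prod
        (betaMeasure ((k : ℝ) + 1) ((N : ℝ) - k))).map (fun q => q.2 - q.1) := by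
  rw [← map_ordered_pointsLaw k, Measure.map_map (by fun_prop)]
  · rfl
  · exact ((measurable_ordered k).comp measurable_fst).prodMk
      ((measurable_ordered k).comp measurable_snd)

/-! ### Collapse of the joint densities summed over the ranks -/

lemma integral_choose_mul_pow (n k : ℕ) (hk : k ≤ n) :
    ∫ x in (0 : ℝ)..1, n.choose k * x ^ k * (1 - x) ^ (n - k) = 1 / ((n : ℝ) + 1) := by
  -- The antiderivative is the binomial tail, which rises from 0 to 1.
  have hFTC := intervalIntegral.integral_eq_sub_of_hasDerivAt (a := 0) (b := 1)
    (fun t _ => hasDerivAt_binomialTail n k hk t)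
    ((continuous_orderDensity n k).intervalIntegrable _ _)
  have h0 : ∑ m ∈ Finset.Ico (k + 1 : ℕ) (n + 2),
      (bernsteinPolynomial ℝ (n + 1) m).eval 0 = 0 := by
    refine Finset.sum_eq_zero fun m hm => ?_
    have : m ≠ 0 := by have := (Finset.mem_Ico.1 hm).1; omega
    simp [bernsteinPolynomial, this]
  have h1 : ∑ m ∈ Finset.Ico (k + 1 : ℕ) (n + 2),
      (bernsteinPolynomial ℝ (n + 1) m).eval 1 = 1 := by
    rw [Finset.sum_eq_single_of_mem (n + 1) (by simp; omega)]
    · simp [bernsteinPolynomial]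
    · intro m hm hne
      have : n + 1 - m ≠ 0 := by have := (Finset.mem_Ico.1 hm).2; omega
      simp [bernsteinPolynomial, this]
  rw [h0, h1, sub_zero] at hFTC
  unfold orderDensity at hFTC
  rw [intervalIntegral.integral_const_mul] at hFTC
  rw [eq_div_iff (by positivity), mul_comm, hFTC]

/-- Up to the factor `(n + 1) ^ 2`, the sum over the ranks of the joint densities of the two order
statistics of equal rank of two samples of `n + 1` points. -/
noncomputable def pairDensity (n : ℕ) (x y : ℝ) : ℝ :=
  ∑ k ∈ Finset.range (n + 1),
    (n.choose k : ℝ) ^ 2 * (x * y) ^ k * ((1 - x) * (1 - y)) ^ (n - k)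

lemma continuous_pairDensity (n : ℕ) : Continuous fun z : ℝ × ℝ => pairDensity n z.1 z.2 := by
  unfold pairDensity; fun_prop

lemma pairDensity_comm (n : ℕ) (x y : ℝ) : pairDensity n x y = pairDensity n y x := by
  unfold pairDensity
  simp only [mul_comm x y, mul_comm (1 - x) (1 - y)]

lemma sum_orderDensity_mul (n : ℕ) (x y : ℝ) :
    ∑ k ∈ Finset.range (n + 1), orderDensity n k x * orderDensity n k y =
      ((n : ℝ) + 1) ^ 2 * pairDensity n x y := by
  unfold pairDensity orderDensity
  rw [Finset.mul_sum]
  refine Finset.sum_congr rfl fun k _ => ?_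
  rw [mul_pow, mul_pow]
  ring

open Polynomial in
lemma coeff_linear_pow (a b : ℝ) (n k : ℕ) :
    ((C a + C b * X) ^ n : ℝ[X]).coeff k = n.choose k * a ^ (n - k) * b ^ k := by
  have h : (C a + C b * X : ℝ[X]) ^ n = ((X + C a) ^ n).comp (C b * X) := by
    simp [add_comm]
  rw [h, comp_C_mul_X_coeff, coeff_X_add_C_pow]
  ring

open Polynomial in
-- Both sides are the coefficient of X^n in R^n P^n. When s + t = 1, R = (h - 1) P + (1 + X), and
-- the right side is the binomial expansion of R^n in these two terms.
lemma sum_choose_sq_expand (n : ℕ) (h s t : ℝ) (hst : s + t = 1) :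
    ∑ k ∈ Finset.range (n + 1),
        (n.choose k : ℝ) ^ 2 * (s * (s + h * t)) ^ k * (t * (t + h * s)) ^ (n - k) =
      ∑ i ∈ Finset.range (n + 1), (n.choose i : ℝ) * (h - 1) ^ i *
        ∑ k ∈ Finset.range (n + 1), ((n - i).choose k : ℝ) *
          ((n + i).choose (n - k) * s ^ (i + k) * t ^ (n - k)) := by
  set P : ℝ[X] := C s + C t * X with hP
  set R : ℝ[X] := C (t + h * s) + C (s + h * t) * X with hR
  have hL : (R ^ n * P ^ n).coeff n = ∑ k ∈ Finset.range (n + 1),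
      (n.choose k : ℝ) ^ 2 * (s * (s + h * t)) ^ k * (t * (t + h * s)) ^ (n - k) := by
    rw [coeff_mul, Finset.Nat.sum_antidiagonal_eq_sum_range_succ_mk]
    refine Finset.sum_congr rfl fun k hk => ?_
    have hk' : k ≤ n := Nat.lt_succ_iff.1 (Finset.mem_range.1 hk)
    simp only [hP, hR, coeff_linear_pow]
    rw [Nat.choose_symm hk', Nat.sub_sub_self hk', mul_pow, mul_pow]
    ring
  have hRP : R = C (h - 1) * P + (C 1 + C 1 * X) := by
    have h1 : t + h * s = (h - 1) * s + 1 := by linear_combination hst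
    have h2 : s + h * t = (h - 1) * t + 1 := by linear_combination hst
    rw [hR, hP, h1, h2]
    simp only [C_add, C_mul]
    ring
  have hexp : R ^ n * P ^ n = ∑ i ∈ Finset.range (n + 1),
      C ((n.choose i : ℝ) * (h - 1) ^ i) * ((C 1 + C 1 * X) ^ (n - i) * P ^ (n + i)) := by
    rw [hRP, add_pow, Finset.sum_mul]
    refine Finset.sum_congr rfl fun i _ => ?_
    rw [mul_pow, pow_add, C_mul, C_pow]
    simp only [map_natCast]
    ring
  rw [← hL, hexp, finsetSum_coeff]
  refine Finset.sum_congr rfl fun i _ => ?_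
  rw [coeff_C_mul, coeff_mul, Finset.Nat.sum_antidiagonal_eq_sum_range_succ_mk]
  congr 1
  refine Finset.sum_congr rfl fun k hk => ?_
  have hk' : k ≤ n := Nat.lt_succ_iff.1 (Finset.mem_range.1 hk)
  simp only [hP, coeff_linear_pow]
  rw [show n + i - (n - k) = i + k by omega]
  ring

/-- After the expansion every s-integral is a normalized Beta integral with value 1/(n+i+1),
independent of k; the remaining binomial coefficients sum to 2^(n-i). -/
lemma integral_sum_choose_sq (n : ℕ) (h : ℝ) :
    ∫ s in (0 : ℝ)..1, ∑ k ∈ Finset.range (n + 1), (n.choose k : ℝ) ^ 2 *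
        (s * (s + h * (1 - s))) ^ k * ((1 - s) * ((1 - s) + h * s)) ^ (n - k) =
      ∑ i ∈ Finset.range (n + 1), (n.choose i : ℝ) * (h - 1) ^ i *
        (2 ^ (n - i) * (1 / ((n : ℝ) + i + 1))) := by
  simp_rw [fun s : ℝ => sum_choose_sq_expand n h s (1 - s) (by ring)]
  rw [intervalIntegral.integral_finsetSum
    fun i _ => Continuous.intervalIntegrable (by fun_prop) _ _]
  refine Finset.sum_congr rfl fun i hi => ?_
  have hi' : i ≤ n := Nat.lt_succ_iff.1 (Finset.mem_range.1 hi)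
  rw [intervalIntegral.integral_const_mul, intervalIntegral.integral_finsetSum
    fun i _ => Continuous.intervalIntegrable (by fun_prop) _ _]
  congr 1
  have hterm : ∀ k ∈ Finset.range (n + 1),
      (∫ s in (0 : ℝ)..1, ((n - i).choose k : ℝ) *
        ((n + i).choose (n - k) * s ^ (i + k) * (1 - s) ^ (n - k))) =
      ((n - i).choose k : ℝ) * (1 / ((n : ℝ) + i + 1)) := by
    intro k hk
    have hk' : k ≤ n := Nat.lt_succ_iff.1 (Finset.mem_range.1 hk)
    have h1 := integral_choose_mul_pow (n + i) (i + k) (by omega)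
    rw [show n + i - (i + k) = n - k by omega,
      ← Nat.choose_symm (show i + k ≤ n + i by omega),
      show n + i - (i + k) = n - k by omega] at h1
    rw [intervalIntegral.integral_const_mul, h1]
    push_cast
    rfl
  rw [Finset.sum_congr rfl hterm, ← Finset.sum_mul]
  congr 1
  have hsub : Finset.range (n - i + 1) ⊆ Finset.range (n + 1) := by
    intro k hk
    simp only [Finset.mem_range] at *
    omega
  rw [← Finset.sum_subset hsub, ← Nat.cast_sum, Nat.sum_range_choose]
  · push_cast
    rfl
  · intro k _ hk
    simp only [Finset.mem_range] at hk
    rw [Nat.choose_eq_zero_of_lt (by omega), Nat.cast_zero]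

lemma integral_pow_mul_pow (n : ℕ) (h : ℝ) :
    ∫ u in (0 : ℝ)..1, u ^ n * (2 - (1 - h) * u) ^ n =
      ∑ i ∈ Finset.range (n + 1), (n.choose i : ℝ) * (h - 1) ^ i *
        (2 ^ (n - i) * (1 / ((n : ℝ) + i + 1))) := by
  have hexp : ∀ u : ℝ, u ^ n * (2 - (1 - h) * u) ^ n = ∑ i ∈ Finset.range (n + 1),
      (n.choose i : ℝ) * (h - 1) ^ i * (2 ^ (n - i) * u ^ (n + i)) := by
    intro u
    rw [show 2 - (1 - h) * u = (h - 1) * u + 2 by ring, add_pow, Finset.mul_sum]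
    refine Finset.sum_congr rfl fun i _ => ?_
    rw [mul_pow, pow_add]
    ring
  simp_rw [hexp]
  rw [intervalIntegral.integral_finsetSum
    fun i _ => Continuous.intervalIntegrable (by fun_prop) _ _]
  refine Finset.sum_congr rfl fun i _ => ?_
  rw [intervalIntegral.integral_const_mul, intervalIntegral.integral_const_mul, integral_pow]
  push_cast
  simp

/-- The density of the absolute displacement, summed over the ranks. -/
lemma integral_pairDensity (n : ℕ) (h : ℝ) :
    (1 - h) * ∫ s in (0 : ℝ)..1, pairDensity n ((1 - h) * s) ((1 - h) * s + h) =
      ∫ τ in h..1, (1 - τ ^ 2) ^ n := by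
  have h1 : ∀ s : ℝ, pairDensity n ((1 - h) * s) ((1 - h) * s + h) = (1 - h) ^ n *
      ∑ k ∈ Finset.range (n + 1), (n.choose k : ℝ) ^ 2 *
        (s * (s + h * (1 - s))) ^ k * ((1 - s) * ((1 - s) + h * s)) ^ (n - k) := by
    intro s
    rw [pairDensity, Finset.mul_sum]
    refine Finset.sum_congr rfl fun k hk => ?_
    have hk' : k ≤ n := Nat.lt_succ_iff.1 (Finset.mem_range.1 hk)
    rw [show (1 - h) * s * ((1 - h) * s + h) = (1 - h) * (s * (s + h * (1 - s))) by ring,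
      show (1 - (1 - h) * s) * (1 - ((1 - h) * s + h)) =
        (1 - h) * ((1 - s) * ((1 - s) + h * s)) by ring, mul_pow (1 - h), mul_pow (1 - h),
      ← pow_mul_pow_sub (1 - h) hk']
    ring
  have h2 : ∀ u : ℝ, (1 - (1 - (1 - h) * u) ^ 2) ^ n =
      (1 - h) ^ n * (u ^ n * (2 - (1 - h) * u) ^ n) := by
    intro u
    rw [← mul_pow, ← mul_pow]
    ring
  -- The substitution τ = 1 - (1 - h) u turns the right side into an integral with the same binomial
  -- expansion as the left.
  have h3 := intervalIntegral.mul_integral_comp_sub_mul (a := 0) (b := 1)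
    (f := fun τ : ℝ => (1 - τ ^ 2) ^ n) (1 - h) 1
  simp only [mul_one, mul_zero, sub_zero, sub_sub_cancel] at h3
  rw [← h3]
  simp_rw [h1, h2]
  rw [intervalIntegral.integral_const_mul, intervalIntegral.integral_const_mul,
    integral_sum_choose_sq, integral_pow_mul_pow]

/-! ### Beta integrals -/

lemma integral_rpow_mul_one_sub_pow (n : ℕ) {a : ℝ} (ha : 0 ≤ a) :
    ∫ x in (0 : ℝ)..1, x ^ a * (1 - x) ^ n =
      Real.Gamma (a + 1) * n.factorial / Real.Gamma (a + n + 2) := by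
  -- Integration by parts trades one factor 1 - x for one factor x, so `a` must vary.
  induction n generalizing a with
  | zero =>
    have hg : Real.Gamma (a + 1) ≠ 0 := (Real.Gamma_pos_of_pos (by linarith)).ne'
    have h2 : Real.Gamma (a + 2) = (a + 1) * Real.Gamma (a + 1) := by
      rw [← Real.Gamma_add_one (by linarith)]; ring_nf
    simp only [pow_zero, mul_one, Nat.cast_zero, add_zero, Nat.factorial_zero, Nat.cast_one, h2]
    rw [integral_rpow (Or.inl (by linarith)), Real.one_rpow, Real.zero_rpow (by linarith)]
    field_simp
    simp
  | succ n ih =>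
    have h1 : ∀ x ∈ Set.uIcc (0 : ℝ) 1,
        HasDerivAt (fun x : ℝ => (1 - x) ^ (n + 1)) (-((n + 1) * (1 - x) ^ n)) x := by
      intro x _
      have := ((hasDerivAt_id x).const_sub 1).pow (n + 1)
      refine this.congr_deriv ?_
      simp
    have h2 : ∀ x ∈ Set.uIcc (0 : ℝ) 1,
        HasDerivAt (fun x : ℝ => x ^ (a + 1) / (a + 1)) (x ^ a) x := by
      intro x _
      have := (Real.hasDerivAt_rpow_const (x := x) (p := a + 1) (Or.inr (by linarith))).div_const
        (a + 1)
      refine this.congr_deriv ?_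
      rw [add_sub_cancel_right]
      field_simp
    have hcont : Continuous fun x : ℝ => x ^ a := continuous_id.rpow_const fun _ => Or.inr ha
    have hparts := intervalIntegral.integral_mul_deriv_eq_deriv_mul h1 h2
      (Continuous.intervalIntegrable (by fun_prop) _ _) (hcont.intervalIntegrable _ _)
    have hcomm : ∀ x : ℝ, x ^ a * (1 - x) ^ (n + 1) = (1 - x) ^ (n + 1) * x ^ a :=
      fun x => mul_comm _ _
    have hinner : ∀ x : ℝ, -((n + 1) * (1 - x) ^ n) * (x ^ (a + 1) / (a + 1)) =
        -((n + 1) / (a + 1)) * (x ^ (a + 1) * (1 - x) ^ n) := fun x => by ring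
    simp_rw [hcomm]
    rw [hparts]
    simp_rw [hinner]
    rw [intervalIntegral.integral_const_mul, ih (by linarith), Real.zero_rpow (by linarith),
      Real.Gamma_add_one (s := a + 1) (by linarith), Nat.factorial_succ]
    push_cast
    rw [show a + 1 + n + 2 = a + (n + 1) + 2 by ring]
    have : a + 1 ≠ 0 := by linarith
    field_simp
    simp

lemma integral_rpow_mul_one_sub_sq_pow (n : ℕ) {p : ℝ} (hp : 0 ≤ p) :
    ∫ x in (0 : ℝ)..1, x ^ (p + 1) * (1 - x ^ 2) ^ n =
      Real.Gamma (1 + p / 2) * n.factorial / (2 * Real.Gamma (p / 2 + n + 2)) := by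
  have hcont : Continuous fun x : ℝ => x ^ (p / 2) * (1 - x) ^ n :=
    (continuous_id.rpow_const fun _ => Or.inr (by positivity)).mul (by fun_prop)
  have hsub := intervalIntegral.integral_comp_mul_deriv (a := 0) (b := 1)
    (f := fun x : ℝ => x ^ 2) (f' := fun x => 2 * x) (g := fun x : ℝ => x ^ (p / 2) * (1 - x) ^ n)
    (fun x _ => by simpa using hasDerivAt_pow 2 x) (by fun_prop) hcont
  simp only [Function.comp_apply] at hsub
  rw [zero_pow two_ne_zero, one_pow, integral_rpow_mul_one_sub_pow n (by positivity)] at hsub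
  have hcongr : ∫ x in (0 : ℝ)..1, x ^ (p + 1) * (1 - x ^ 2) ^ n =
      ∫ x in (0 : ℝ)..1, (1 / 2) * ((x ^ 2) ^ (p / 2) * (1 - x ^ 2) ^ n * (2 * x)) := by
    refine intervalIntegral.integral_congr fun x hx => ?_
    rw [Set.uIcc_of_le zero_le_one] at hx
    have hx2 : (x ^ 2) ^ (p / 2) = x ^ p := by
      rw [← Real.rpow_natCast, ← Real.rpow_mul hx.1]
      congr 1
      push_cast
      ring
    rw [hx2, Real.rpow_add_one' hx.1 (by linarith)]
    ring
  rw [hcongr, intervalIntegral.integral_const_mul, hsub, add_comm (p / 2) 1]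
  field_simp

/-- Integration by parts in h: the boundary terms vanish, at 1 because the inner integral is empty
and at 0 because of the power. -/
lemma integral_rpow_mul_integral (n : ℕ) {p : ℝ} (hp : 0 ≤ p) :
    ∫ h in (0 : ℝ)..1, h ^ p * ∫ τ in h..1, (1 - τ ^ 2) ^ n =
      1 / (p + 1) * (Real.Gamma (1 + p / 2) * n.factorial / (2 * Real.Gamma (p / 2 + n + 2))) := by
  rw [← integral_rpow_mul_one_sub_sq_pow n hp]
  have hc : Continuous fun τ : ℝ => (1 - τ ^ 2) ^ n := by fun_prop
  have h1 : ∀ x ∈ Set.uIcc (0 : ℝ) 1,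
      HasDerivAt (fun h : ℝ => ∫ τ in h..1, (1 - τ ^ 2) ^ n) (-(1 - x ^ 2) ^ n) x := fun x _ =>
    intervalIntegral.integral_hasDerivAt_left (hc.intervalIntegrable _ _)
      (hc.stronglyMeasurableAtFilter _ _) hc.continuousAt
  have h2 : ∀ x ∈ Set.uIcc (0 : ℝ) 1,
      HasDerivAt (fun x : ℝ => x ^ (p + 1) / (p + 1)) (x ^ p) x := by
    intro x _
    have := (Real.hasDerivAt_rpow_const (x := x) (p := p + 1) (Or.inr (by linarith))).div_const
      (p + 1)
    refine this.congr_deriv ?_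
    rw [add_sub_cancel_right]
    field_simp
  have hcont : Continuous fun x : ℝ => x ^ p := continuous_id.rpow_const fun _ => Or.inr hp
  have hparts := intervalIntegral.integral_mul_deriv_eq_deriv_mul h1 h2
    (Continuous.intervalIntegrable (by fun_prop) _ _) (hcont.intervalIntegrable _ _)
  have hinner : ∀ x : ℝ, -(1 - x ^ 2) ^ n * (x ^ (p + 1) / (p + 1)) =
      -(1 / (p + 1)) * (x ^ (p + 1) * (1 - x ^ 2) ^ n) := fun x => by ring
  simp_rw [mul_comm (_ ^ p)]
  rw [hparts]
  simp_rw [hinner]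
  rw [intervalIntegral.integral_const_mul, intervalIntegral.integral_same,
    Real.zero_rpow (by linarith)]
  ring

/-! ### Integration over the square along lines of constant difference -/

lemma integral_triangle_swap {H : ℝ → ℝ → ℝ} (hH : Continuous H.uncurry) :
    ∫ x in (0 : ℝ)..1, ∫ h in (0 : ℝ)..(1 - x), H x h =
      ∫ h in (0 : ℝ)..1, ∫ x in (0 : ℝ)..(1 - h), H x h := by
  have hT : MeasurableSet {z : ℝ × ℝ | z.1 + z.2 ≤ 1} :=
    measurableSet_le (by fun_prop) measurable_const
  have hint : IntegrableOn
      (Function.uncurry fun x h => ({z : ℝ × ℝ | z.1 + z.2 ≤ 1}.indicator H.uncurry) (x, h))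
      (Set.uIoc 0 1 ×ˢ Set.uIoc 0 1) := by
    have h1 : IntegrableOn H.uncurry (Set.uIoc 0 1 ×ˢ Set.uIoc 0 1) :=
      (hH.continuousOn.integrableOn_compact (isCompact_Icc.prod isCompact_Icc)).mono_set
        (Set.prod_mono Set.uIoc_subset_uIcc Set.uIoc_subset_uIcc)
    exact h1.indicator hT
  have hswap := intervalIntegral_intervalIntegral_swap hint
  have hl : ∀ x ∈ Set.uIcc (0 : ℝ) 1, ∫ h in (0 : ℝ)..1,
      ({z : ℝ × ℝ | z.1 + z.2 ≤ 1}.indicator H.uncurry) (x, h) =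
        ∫ h in (0 : ℝ)..(1 - x), H x h := by
    intro x hx
    rw [Set.uIcc_of_le zero_le_one] at hx
    rw [← intervalIntegral.integral_indicator (a₃ := 1)
      (⟨by linarith [hx.2], by linarith [hx.1]⟩ : 1 - x ∈ Set.Icc 0 1)]
    refine intervalIntegral.integral_congr fun h _ => ?_
    simp [Set.indicator, le_sub_iff_add_le']
  have hr : ∀ h ∈ Set.uIcc (0 : ℝ) 1, ∫ x in (0 : ℝ)..1,
      ({z : ℝ × ℝ | z.1 + z.2 ≤ 1}.indicator H.uncurry) (x, h) =
        ∫ x in (0 : ℝ)..(1 - h), H x h := by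
    intro h hh
    rw [Set.uIcc_of_le zero_le_one] at hh
    rw [← intervalIntegral.integral_indicator (a₃ := 1)
      (⟨by linarith [hh.2], by linarith [hh.1]⟩ : 1 - h ∈ Set.Icc 0 1)]
    refine intervalIntegral.integral_congr fun x _ => ?_
    simp [Set.indicator, le_sub_iff_add_le]
  rw [← intervalIntegral.integral_congr hl, hswap, intervalIntegral.integral_congr hr]

/-- A symmetric function on the unit square, integrated along the lines of constant difference. -/
lemma integral_square_of_symm {G : ℝ → ℝ → ℝ} (hG : Continuous G.uncurry)
    (hsymm : ∀ x y, G x y = G y x) :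
    ∫ x in (0 : ℝ)..1, ∫ y in (0 : ℝ)..1, G x y =
      2 * ∫ h in (0 : ℝ)..1, (1 - h) * ∫ s in (0 : ℝ)..1, G ((1 - h) * s) ((1 - h) * s + h) := by
  have hG' : ∀ {f g : ℝ × ℝ → ℝ}, Continuous f → Continuous g →
      Continuous fun z => G (f z) (g z) := fun hf hg => hG.comp₂ hf hg
  have hGx : ∀ x, Continuous (G x) := fun x => hG.comp₂ continuous_const continuous_id
  have hscale : ∀ h, (1 - h) * ∫ s in (0 : ℝ)..1, G ((1 - h) * s) ((1 - h) * s + h) =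
      ∫ x in (0 : ℝ)..(1 - h), G x (x + h) := by
    intro h
    have := intervalIntegral.mul_integral_comp_mul_left (a := 0) (b := 1)
      (f := fun x => G x (x + h)) (1 - h)
    simpa using this
  -- Below the diagonal, h = x - y and the reflection x ↦ 1 - x give the triangle x + h ≤ 1; after
  -- the swap a second reflection and the symmetry of `G` give the same integral as above the
  -- diagonal.
  have hlow : ∫ x in (0 : ℝ)..1, ∫ y in (0 : ℝ)..x, G x y =
      ∫ h in (0 : ℝ)..1, ∫ x in (0 : ℝ)..(1 - h), G x (x + h) := by
    have h1 : ∀ x : ℝ, ∫ y in (0 : ℝ)..x, G x y = ∫ h in (0 : ℝ)..x, G x (x - h) := by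
      intro x
      rw [intervalIntegral.integral_comp_sub_left (fun y => G x y) x]
      simp
    have h2 : ∫ x in (0 : ℝ)..1, ∫ h in (0 : ℝ)..x, G x (x - h) =
        ∫ x in (0 : ℝ)..1, ∫ h in (0 : ℝ)..(1 - x), G (1 - x) (1 - x - h) := by
      rw [intervalIntegral.integral_comp_sub_left
        (fun x => ∫ h in (0 : ℝ)..x, G x (x - h)) (1 : ℝ)]
      simp
    simp_rw [h1]
    rw [h2, integral_triangle_swap (H := fun x h => G (1 - x) (1 - x - h))
      (hG' (by fun_prop) (by fun_prop))]
    refine intervalIntegral.integral_congr fun h _ => ?_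
    have h3 := intervalIntegral.integral_comp_sub_left (a := 0) (b := 1 - h)
      (fun w => G (w + h) w) (1 - h)
    simp only [sub_self, sub_zero] at h3
    simp_rw [hsymm _ (_ + h)]
    rw [← h3]
    refine intervalIntegral.integral_congr fun x _ => ?_
    congr 1 <;> ring
  have hup : ∫ x in (0 : ℝ)..1, ∫ y in x..1, G x y =
      ∫ h in (0 : ℝ)..1, ∫ x in (0 : ℝ)..(1 - h), G x (x + h) := by
    have h1 : ∀ x : ℝ, ∫ y in x..1, G x y = ∫ h in (0 : ℝ)..(1 - x), G x (x + h) := by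
      intro x
      rw [intervalIntegral.integral_comp_add_left (fun y => G x y) x]
      simp
    simp_rw [h1]
    exact integral_triangle_swap (H := fun x h => G x (x + h)) (hG' (by fun_prop) (by fun_prop))
  have hsplit : ∀ x : ℝ, ∫ y in (0 : ℝ)..1, G x y =
      (∫ y in (0 : ℝ)..x, G x y) + ∫ y in x..1, G x y := fun x =>
    (intervalIntegral.integral_add_adjacent_intervals ((hGx x).intervalIntegrable _ _)
      ((hGx x).intervalIntegrable _ _)).symm
  have hc1 : Continuous fun x : ℝ => ∫ y in (0 : ℝ)..x, G x y :=
    intervalIntegral.continuous_parametric_intervalIntegral_of_continuous hG continuous_id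
  have hc2 : Continuous fun x : ℝ => ∫ y in x..1, G x y := by
    simp_rw [fun x : ℝ => intervalIntegral.integral_symm (μ := volume) (f := G x) 1 x]
    exact (intervalIntegral.continuous_parametric_intervalIntegral_of_continuous hG
      continuous_id).neg
  simp_rw [hsplit, hscale]
  rw [intervalIntegral.integral_add (hc1.intervalIntegrable _ _) (hc2.intervalIntegrable _ _),
    hlow, hup]
  ring

lemma integral_pairDensity_mul_abs_rpow (n : ℕ) {p : ℝ} (hp : 0 ≤ p) :
    ∫ x in (0 : ℝ)..1, ∫ y in (0 : ℝ)..1, pairDensity n x y * |y - x| ^ p =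
      1 / (p + 1) * (Real.Gamma (1 + p / 2) * n.factorial / Real.Gamma (p / 2 + n + 2)) := by
  rw [integral_square_of_symm (G := fun x y => pairDensity n x y * |y - x| ^ p)]
  · have h1 : ∫ h in (0 : ℝ)..1, (1 - h) * ∫ s in (0 : ℝ)..1,
        pairDensity n ((1 - h) * s) ((1 - h) * s + h) * |(1 - h) * s + h - (1 - h) * s| ^ p =
        ∫ h in (0 : ℝ)..1, h ^ p * ∫ τ in h..1, (1 - τ ^ 2) ^ n := by
      refine intervalIntegral.integral_congr fun h hh => ?_
      rw [Set.uIcc_of_le zero_le_one] at hh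
      simp only [add_sub_cancel_left, abs_of_nonneg hh.1]
      rw [intervalIntegral.integral_mul_const, ← integral_pairDensity]
      ring
    rw [h1, integral_rpow_mul_integral n hp]
    ring
  · refine (continuous_pairDensity n).mul (Continuous.rpow_const ?_ fun _ => Or.inr hp)
    fun_prop
  · intro x y
    rw [pairDensity_comm, abs_sub_comm]

/-! ### The exact average cost and the displacement field -/

lemma ae_betaMeasure_mem {n k : ℕ} (hk : k ≤ n) :
    ∀ᵐ x ∂betaMeasure ((k : ℝ) + 1) (((n + 1 : ℕ) : ℝ) - k), x ∈ Set.Ioc (0 : ℝ) 1 := by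
  rw [betaMeasure_eq_withDensity n k hk]
  exact (withDensity_absolutelyContinuous _ _).ae_le (ae_restrict_mem measurableSet_Ioc)

lemma integral_betaMeasure {n k : ℕ} (hk : k ≤ n) (g : ℝ → ℝ) :
    ∫ x, g x ∂betaMeasure ((k : ℝ) + 1) (((n + 1 : ℕ) : ℝ) - k) =
      ∫ x in (0 : ℝ)..1, orderDensity n k x * g x := by
  rw [betaMeasure_eq_withDensity n k hk, integral_withDensity_eq_integral_toReal_smul
    (continuous_orderDensity n k).measurable.ennreal_ofReal (by simp),
    intervalIntegral.integral_of_le zero_le_one]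
  refine setIntegral_congr_fun measurableSet_Ioc fun x hx => ?_
  simp only [smul_eq_mul]
  rw [ENNReal.toReal_ofReal (orderDensity_nonneg n k hx.1.le hx.2)]

lemma integrable_abs_sub_rpow_beta {n k : ℕ} (hk : k ≤ n) {p : ℝ} (hp : 0 ≤ p) :
    Integrable (fun q : ℝ × ℝ => |q.2 - q.1| ^ p)
      ((betaMeasure ((k : ℝ) + 1) (((n + 1 : ℕ) : ℝ) - k)).prod
        (betaMeasure ((k : ℝ) + 1) (((n + 1 : ℕ) : ℝ) - k))) := by
  have hkn : (k : ℝ) < ((n + 1 : ℕ) : ℝ) := by exact_mod_cast Nat.lt_succ_of_le hk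
  have := isProbabilityMeasureBeta (α := (k : ℝ) + 1) (β := ((n + 1 : ℕ) : ℝ) - k)
    (by positivity) (by linarith)
  refine Integrable.of_bound (C := 1) ?_ ?_
  · exact (Continuous.rpow_const (by fun_prop) fun _ => Or.inr hp).aestronglyMeasurable
  · filter_upwards [Measure.quasiMeasurePreserving_fst.ae (ae_betaMeasure_mem hk),
      Measure.quasiMeasurePreserving_snd.ae (ae_betaMeasure_mem hk)] with q h1 h2
    rw [Real.norm_of_nonneg (by positivity)]
    refine Real.rpow_le_one (abs_nonneg _) ?_ hp
    rw [abs_le]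
    constructor <;> linarith [h1.1, h1.2, h2.1, h2.2]

lemma measurable_ordered_pair {N : ℕ} (k : Fin N) :
    Measurable fun z : (Fin N → ℝ) × (Fin N → ℝ) => (ordered z.1 k, ordered z.2 k) :=
  ((measurable_ordered k).comp measurable_fst).prodMk ((measurable_ordered k).comp measurable_snd)

lemma integrable_abs_ordered_sub_rpow {N : ℕ} (k : Fin N) {p : ℝ} (hp : 0 ≤ p) :
    Integrable (fun z => |ordered z.2 k - ordered z.1 k| ^ p) (pointsLaw N) := by
  obtain ⟨n, rfl⟩ : ∃ n, N = n + 1 := Nat.exists_eq_succ_of_ne_zero (Fin.pos k).ne'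
  have h := integrable_abs_sub_rpow_beta (Nat.lt_succ_iff.1 k.2) hp
  rw [← map_ordered_pointsLaw k] at h
  exact h.comp_measurable (measurable_ordered_pair k)

lemma integral_abs_ordered_sub_rpow {n : ℕ} (k : Fin (n + 1)) {p : ℝ} (hp : 0 ≤ p) :
    ∫ z, |ordered z.2 k - ordered z.1 k| ^ p ∂pointsLaw (n + 1) =
      ∫ x in (0 : ℝ)..1, ∫ y in (0 : ℝ)..1,
        orderDensity n k x * orderDensity n k y * |y - x| ^ p := by
  have hk := Nat.lt_succ_iff.1 k.2
  have hkn : ((k : ℕ) : ℝ) < ((n + 1 : ℕ) : ℝ) := by exact_mod_cast k.2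
  have := isProbabilityMeasureBeta (α := (k : ℝ) + 1) (β := ((n + 1 : ℕ) : ℝ) - k)
    (by positivity) (by linarith)
  have hcont : Continuous fun q : ℝ × ℝ => |q.2 - q.1| ^ p :=
    Continuous.rpow_const (by fun_prop) fun _ => Or.inr hp
  have h1 := integral_map (μ := pointsLaw (n + 1)) (measurable_ordered_pair k).aemeasurable
    hcont.aestronglyMeasurable
  rw [← h1, map_ordered_pointsLaw k, integral_prod _ (integrable_abs_sub_rpow_beta hk hp),
    integral_betaMeasure hk]
  refine intervalIntegral.integral_congr fun x _ => ?_
  rw [integral_betaMeasure hk, ← intervalIntegral.integral_const_mul]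
  refine intervalIntegral.integral_congr fun y _ => ?_
  simp only
  ring

lemma sum_integral_abs_ordered_sub_rpow (n : ℕ) {p : ℝ} (hp : 0 ≤ p) :
    ∑ k : Fin (n + 1), ∫ z, |ordered z.2 k - ordered z.1 k| ^ p ∂pointsLaw (n + 1) =
      (n + 1) ^ 2 * (1 / (p + 1) *
        (Real.Gamma (1 + p / 2) * n.factorial / Real.Gamma (p / 2 + n + 2))) := by
  simp_rw [fun k : Fin (n + 1) => integral_abs_ordered_sub_rpow k hp]
  rw [Fin.sum_univ_eq_sum_range (fun k => ∫ x in (0 : ℝ)..1, ∫ y in (0 : ℝ)..1,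
        orderDensity n k x * orderDensity n k y * |y - x| ^ p) (n + 1),
    ← integral_pairDensity_mul_abs_rpow n hp]
  have hc : ∀ k, Continuous (Function.uncurry fun x y : ℝ =>
      orderDensity n k x * orderDensity n k y * |y - x| ^ p) := fun k =>
    (((continuous_orderDensity n k).comp continuous_fst).mul
      ((continuous_orderDensity n k).comp continuous_snd)).mul
        (Continuous.rpow_const (by fun_prop) fun _ => Or.inr hp)
  rw [← intervalIntegral.integral_finsetSum fun k _ =>
    (intervalIntegral.continuous_parametric_intervalIntegral_of_continuous' (hc k)
      0 1).intervalIntegrable _ _, ← intervalIntegral.integral_const_mul]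
  refine intervalIntegral.integral_congr fun x _ => ?_
  have hcx : ∀ k, Continuous fun y : ℝ =>
      orderDensity n k x * orderDensity n k y * |y - x| ^ p := fun k =>
    (hc k).comp₂ continuous_const continuous_id
  rw [← intervalIntegral.integral_finsetSum fun k _ => (hcx k).intervalIntegrable _ _,
    ← intervalIntegral.integral_const_mul]
  refine intervalIntegral.integral_congr fun y _ => ?_
  rw [← mul_assoc, ← sum_orderDensity_mul, Finset.sum_mul]

lemma integrable_optMeanCost {p : ℝ} (hp : 1 < p) (N : ℕ) :
    Integrable (fun z : (Fin N → ℝ) × (Fin N → ℝ) =>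
      optMeanCost p (ordered z.1) (ordered z.2)) (pointsLaw N) := by
  simp_rw [optMeanCost_ordered hp]
  exact (integrable_finsetSum _ fun k _ =>
    integrable_abs_ordered_sub_rpow k (by linarith)).const_mul _

lemma avgOptCost_eq_sum {p : ℝ} (hp : 1 < p) (N : ℕ) :
    avgOptCost p N =
      1 / (N : ℝ) * ∑ k : Fin N, ∫ z, |ordered z.2 k - ordered z.1 k| ^ p ∂pointsLaw N := by
  unfold avgOptCost
  simp_rw [optMeanCost_ordered hp]
  rw [integral_const_mul, integral_finsetSum _ fun k _ =>
    integrable_abs_ordered_sub_rpow k (by linarith)]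

/-- The exact value of the average optimal cost. -/
lemma avgOptCost_eq {p : ℝ} (hp : 1 < p) {N : ℕ} (hN : 1 ≤ N) :
    avgOptCost p N = Real.Gamma (1 + p / 2) / (p + 1) *
      (Real.Gamma (N + 1) / Real.Gamma (N + 1 + p / 2)) := by
  obtain ⟨n, rfl⟩ : ∃ n, N = n + 1 := Nat.exists_eq_succ_of_ne_zero (by omega)
  rw [avgOptCost_eq_sum hp, sum_integral_abs_ordered_sub_rpow n (by linarith),
    Real.Gamma_nat_eq_factorial, Nat.factorial_succ]
  push_cast
  rw [show (n : ℝ) + 1 + 1 + p / 2 = p / 2 + n + 2 by ring]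
  field_simp

/-- The average optimal cost is the `L^p` norm of the displacement field. -/
lemma avgOptCost_eq_integral_displacement {p : ℝ} (hp : 1 < p) {N : ℕ} (hN : 1 ≤ N) :
    (N : ℝ) ^ (p / 2) * avgOptCost p N =
      ∫ s in (0 : ℝ)..1, ∫ z, |displacement z.1 z.2 s| ^ p ∂(pointsLaw N) := by
  have hN0 : (0 : ℝ) < N := by exact_mod_cast hN
  set F : ℝ → ℝ := fun s => ∫ z, |displacement z.1 z.2 s| ^ p ∂(pointsLaw N) with hF
  have hpow : √(N : ℝ) ^ p = (N : ℝ) ^ (p / 2) := by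
    rw [Real.sqrt_eq_rpow, ← Real.rpow_mul hN0.le]
    congr 1
    ring
  have hFval : ∀ k : Fin N, ∀ s ∈ Set.Ico ((k : ℕ) / (N : ℝ)) (((k : ℕ) + 1 : ℕ) / (N : ℝ)),
      F s = (N : ℝ) ^ (p / 2) * ∫ z, |ordered z.2 k - ordered z.1 k| ^ p ∂pointsLaw N := by
    intro k s hs
    have hfloor : ⌊(N : ℝ) * s⌋₊ = k := by
      have h1 : 0 ≤ (N : ℝ) * s :=
        mul_nonneg hN0.le (le_trans (by positivity) hs.1)
      rw [Nat.floor_eq_iff h1]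
      have h2 := hs.1
      have h3 := hs.2
      rw [div_le_iff₀ hN0] at h2
      rw [lt_div_iff₀ hN0] at h3
      push_cast at h3
      constructor <;> linarith
    have hd : ∀ z : (Fin N → ℝ) × (Fin N → ℝ), |displacement z.1 z.2 s| ^ p =
        (N : ℝ) ^ (p / 2) * |ordered z.2 k - ordered z.1 k| ^ p := by
      intro z
      have hlt : ⌊(N : ℝ) * s⌋₊ < N := by rw [hfloor]; exact k.2
      have hk : (⟨⌊(N : ℝ) * s⌋₊, hlt⟩ : Fin N) = k := Fin.ext hfloor
      rw [displacement, dif_pos hlt, hk, abs_mul, abs_of_nonneg (Real.sqrt_nonneg _),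
        Real.mul_rpow (Real.sqrt_nonneg _) (abs_nonneg _), hpow]
    simp only [hF]
    simp_rw [hd]
    rw [integral_const_mul]
  have hstep : ∀ k : Fin N, ∀ᵐ s, s ∈ Set.uIoc ((k : ℕ) / (N : ℝ)) (((k : ℕ) + 1 : ℕ) / (N : ℝ)) →
      F s = (N : ℝ) ^ (p / 2) * ∫ z, |ordered z.2 k - ordered z.1 k| ^ p ∂pointsLaw N := by
    intro k
    have hle : ((k : ℕ) / (N : ℝ)) ≤ (((k : ℕ) + 1 : ℕ) / (N : ℝ)) := by
      gcongr
      simp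
    filter_upwards [Measure.ae_ne volume (((k : ℕ) + 1 : ℕ) / (N : ℝ))] with s hs hs'
    rw [Set.uIoc_of_le hle] at hs'
    -- The field is constant on cells closed on the left, while interval integrals use cells closed
    -- on the right; only the right endpoint is discarded.
    exact hFval k s ⟨hs'.1.le, lt_of_le_of_ne hs'.2 hs⟩
  have hint : ∀ k < N, IntervalIntegrable F volume (((k : ℕ) : ℝ) / N) (((k + 1 : ℕ) : ℝ) / N) := by
    intro k hk
    refine (intervalIntegrable_const (c := (N : ℝ) ^ (p / 2) *
      ∫ z, |ordered z.2 ⟨k, hk⟩ - ordered z.1 ⟨k, hk⟩| ^ p ∂pointsLaw N)).congr_ae ?_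
    rw [EventuallyEq, ae_restrict_iff' measurableSet_uIoc]
    filter_upwards [hstep ⟨k, hk⟩] with s hs hs'
    exact (hs hs').symm
  have hsum := intervalIntegral.sum_integral_adjacent_intervals
    (a := fun k : ℕ => (k : ℝ) / N) hint
  simp only [Nat.cast_zero, zero_div, div_self hN0.ne'] at hsum
  rw [← hsum, ← Fin.sum_univ_eq_sum_range
    (fun k => ∫ s in ((k : ℕ) : ℝ) / N..((k + 1 : ℕ) : ℝ) / N, F s), avgOptCost_eq_sum hp,
    Finset.mul_sum, Finset.mul_sum]
  refine Finset.sum_congr rfl fun k _ => ?_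
  rw [intervalIntegral.integral_congr_ae (hstep k), intervalIntegral.integral_const, smul_eq_mul,
    ← sub_div]
  push_cast
  ring

/-! ### Asymptotics of the Gamma quotient -/

open Topology

/-- Since c'/(n(n+1)) telescopes, u n + c'/n is eventually decreasing; its limit is 0, so it is
nonnegative. -/
lemma eventually_neg_le_of_diff {u : ℕ → ℝ} {c c' : ℝ} (hu : Tendsto u atTop (𝓝 0))
    (hd : Tendsto (fun n : ℕ => (u (n + 1) - u n) * (n * (n + 1))) atTop (𝓝 c)) (hc : c < c') :
    ∀ᶠ n : ℕ in atTop, -c' ≤ n * u n := by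
  obtain ⟨n₀, hn₀⟩ := eventually_atTop.1 ((hd.eventually_lt_const hc).and (eventually_ge_atTop 1))
  let v : ℕ → ℝ := fun n => u n + c' / n
  have hv : Tendsto v atTop (𝓝 0) := by
    simpa using hu.add (tendsto_const_div_atTop_nhds_zero_nat c')
  filter_upwards [eventually_ge_atTop n₀] with n hn
  have hanti : Antitone fun k => v (n + k) := by
    refine antitone_nat_of_succ_le fun k => ?_
    obtain ⟨h1, h2⟩ := hn₀ (n + k) (by omega)
    have hpos : (0 : ℝ) < (n + k : ℕ) := by exact_mod_cast (by omega : 0 < n + k)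
    have h3 : u (n + k + 1) - u (n + k) ≤ c' / (((n + k : ℕ) : ℝ) * ((n + k : ℕ) + 1)) := by
      rw [le_div_iff₀ (by positivity)]
      exact h1.le
    have h4 : c' / (((n + k : ℕ) : ℝ) * ((n + k : ℕ) + 1)) =
        c' / (n + k : ℕ) - c' / ((n + k + 1 : ℕ) : ℝ) := by
      push_cast at hpos ⊢
      field_simp
      ring
    simp only [v, ← add_assoc]
    linarith
  have hlim : Tendsto (fun k => v (n + k)) atTop (𝓝 0) := by
    simpa [add_comm] using (tendsto_add_atTop_iff_nat n).2 hv
  have h0 : 0 ≤ v n := by simpa using hanti.le_of_tendsto hlim 0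
  have hpos : (0 : ℝ) < n := by exact_mod_cast (hn₀ n hn).2
  have h5 : 0 ≤ n * v n := mul_nonneg hpos.le h0
  have h6 : n * v n = n * u n + c' := by
    simp only [v]
    field_simp
  linarith

/-- A Stolz–Cesàro statement for null sequences compared with `1 / n`. -/
lemma tendsto_mul_of_diff {u : ℕ → ℝ} {c : ℝ} (hu : Tendsto u atTop (𝓝 0))
    (hd : Tendsto (fun n : ℕ => (u (n + 1) - u n) * (n * (n + 1))) atTop (𝓝 c)) :
    Tendsto (fun n : ℕ => n * u n) atTop (𝓝 (-c)) := by
  have hd' : Tendsto (fun n : ℕ => ((fun n => -u n) (n + 1) - (fun n => -u n) n) * (n * (n + 1)))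
      atTop (𝓝 (-c)) := by
    refine hd.neg.congr fun n => ?_
    ring
  have hu' : Tendsto (fun n => -u n) atTop (𝓝 0) := by simpa using hu.neg
  refine tendsto_order.2 ⟨fun b hb => ?_, fun b hb => ?_⟩
  -- Here c' is the midpoint of c and -b, so that c < c' and b < -c'. The other bound applies the
  -- same argument to -u.
  · filter_upwards [eventually_neg_le_of_diff hu hd (c' := (c - b) / 2) (by linarith)] with n hn
    linarith
  · filter_upwards [eventually_neg_le_of_diff hu' hd' (c' := (b - c) / 2) (by linarith)] with n hn
    linarith

lemma tendsto_log_one_add_div (b : ℝ) :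
    Tendsto (fun n : ℕ => (Real.log (1 + b / n) - b / n + (b / n) ^ 2 / 2) * (n : ℝ) ^ 2)
      atTop (𝓝 0) := by
  have hb : Tendsto (fun n : ℕ => |b| / (n : ℝ)) atTop (𝓝 0) :=
    tendsto_const_div_atTop_nhds_zero_nat |b|
  have hbound : Tendsto (fun n : ℕ => |b| ^ 2 * (|b| / n) / (1 - |b| / n)) atTop (𝓝 0) := by
    have h := (hb.const_mul (|b| ^ 2)).div (hb.const_sub 1) (by norm_num)
    rw [mul_zero, zero_div] at h
    exact h
  refine squeeze_zero_norm' ?_ hbound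
  filter_upwards [hb.eventually_lt_const one_pos, eventually_ge_atTop 1] with n hn h1
  have hpos : (0 : ℝ) < n := by exact_mod_cast h1
  have habs : |-(b / (n : ℝ))| = |b| / n := by rw [abs_neg, abs_div, abs_of_pos hpos]
  have h := Real.abs_log_sub_add_sum_range_le (x := -(b / n)) (by rwa [habs]) 2
  rw [habs] at h
  simp only [Finset.sum_range_succ, Finset.sum_range_zero] at h
  have he : Real.log (1 + b / n) - b / n + (b / n) ^ 2 / 2 =
      0 + (-(b / (n : ℝ))) ^ (0 + 1) / ((0 : ℕ) + 1) +
        (-(b / (n : ℝ))) ^ (1 + 1) / ((1 : ℕ) + 1) + Real.log (1 - -(b / n)) := by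
    rw [sub_neg_eq_add]
    push_cast
    ring
  rw [norm_mul, Real.norm_eq_abs, he, Real.norm_of_nonneg (by positivity)]
  calc _ ≤ (|b| / n) ^ (2 + 1) / (1 - |b| / n) * (n : ℝ) ^ 2 := by gcongr
    _ = _ := by rw [div_pow]; field_simp; ring

lemma Gamma_add_natCast {a : ℝ} (ha : 0 < a) (n : ℕ) :
    Real.Gamma (a + n) = (∏ j ∈ Finset.range n, (a + j)) * Real.Gamma a := by
  induction n with
  | zero => simp
  | succ n ih =>
    rw [Finset.prod_range_succ, mul_right_comm, ← ih, Nat.cast_succ, ← add_assoc,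
      Real.Gamma_add_one (by positivity), mul_comm]

/-- The normalized ratio of Gamma functions. -/
noncomputable def gammaRatio (a : ℝ) (n : ℕ) : ℝ :=
  (n : ℝ) ^ a * (Real.Gamma (n + 1) / Real.Gamma (n + 1 + a))

/-- Euler's limit formula: the quotient equals `Real.GammaSeq a n / Real.Gamma a`. -/
lemma tendsto_gammaRatio {a : ℝ} (ha : 0 < a) : Tendsto (gammaRatio a) atTop (𝓝 1) := by
  have hg := Real.Gamma_pos_of_pos ha
  have h := (Real.GammaSeq_tendsto_Gamma a).div_const (Real.Gamma a)
  rw [div_self hg.ne'] at h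
  refine h.congr fun n => ?_
  have h1 := Gamma_add_natCast ha (n + 1)
  push_cast at h1
  rw [gammaRatio, Real.Gamma_nat_eq_factorial, add_comm ((n : ℝ) + 1) a, h1, Real.GammaSeq,
    div_div, mul_div_assoc]

lemma gammaRatio_pos {a : ℝ} (ha : 0 < a) {n : ℕ} (hn : 1 ≤ n) : 0 < gammaRatio a n := by
  have hpos : (0 : ℝ) < n := by exact_mod_cast hn
  exact mul_pos (Real.rpow_pos_of_pos hpos _) (div_pos (Real.Gamma_pos_of_pos (by positivity))
    (Real.Gamma_pos_of_pos (by positivity)))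

lemma log_gammaRatio_succ_sub {a : ℝ} (ha : 0 < a) {n : ℕ} (hn : 1 ≤ n) :
    Real.log (gammaRatio a (n + 1)) - Real.log (gammaRatio a n) =
      (a + 1) * Real.log (1 + 1 / n) - Real.log (1 + (a + 1) / n) := by
  have hpos : (0 : ℝ) < n := by exact_mod_cast hn
  have hlog : ∀ m : ℕ, 1 ≤ m → Real.log (gammaRatio a m) =
      a * Real.log m + (Real.log (Real.Gamma (m + 1)) - Real.log (Real.Gamma (m + 1 + a))) := by
    intro m hm
    have hm' : (0 : ℝ) < m := by exact_mod_cast hm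
    have h1 := Real.Gamma_pos_of_pos (show (0 : ℝ) < m + 1 by positivity)
    have h2 := Real.Gamma_pos_of_pos (show (0 : ℝ) < m + 1 + a by positivity)
    rw [gammaRatio, Real.log_mul (Real.rpow_pos_of_pos hm' _).ne' (div_pos h1 h2).ne',
      Real.log_rpow hm', Real.log_div h1.ne' h2.ne']
  have h1 := Real.Gamma_pos_of_pos (show (0 : ℝ) < n + 1 by positivity)
  have h2 := Real.Gamma_pos_of_pos (show (0 : ℝ) < n + 1 + a by positivity)
  rw [hlog n hn, hlog (n + 1) (by omega)]
  push_cast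
  rw [Real.Gamma_add_one (s := (n : ℝ) + 1) (by positivity),
    show (n : ℝ) + 1 + 1 + a = n + 1 + a + 1 by ring,
    Real.Gamma_add_one (s := (n : ℝ) + 1 + a) (by positivity),
    Real.log_mul (by positivity) h1.ne', Real.log_mul (by positivity) h2.ne',
    show 1 + 1 / (n : ℝ) = (n + 1) / n by field_simp,
    show 1 + (a + 1) / (n : ℝ) = (n + 1 + a) / n by field_simp; ring,
    Real.log_div (by positivity) hpos.ne', Real.log_div (by positivity) hpos.ne']
  ring

lemma tendsto_mul_log_gammaRatio {a : ℝ} (ha : 0 < a) :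
    Tendsto (fun n : ℕ => n * Real.log (gammaRatio a n)) atTop (𝓝 (-(a * (a + 1) / 2))) := by
  refine tendsto_mul_of_diff ?_ ?_
  · simpa using (tendsto_gammaRatio ha).log one_ne_zero
  have h1 := (tendsto_log_one_add_div 1).const_mul (a + 1)
  have h2 := tendsto_log_one_add_div (a + 1)
  -- This factor converts n² into n(n+1). The second-order terms of the two logarithms contribute
  -- (a+1)²/2 - (a+1)/2 = a(a+1)/2.
  have h3 : Tendsto (fun n : ℕ => 1 + 1 / (n : ℝ)) atTop (𝓝 1) := by
    simpa using (tendsto_const_div_atTop_nhds_zero_nat (1 : ℝ)).const_add 1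
  have h4 := ((h1.sub h2).add_const (a * (a + 1) / 2)).mul h3
  simp only [mul_zero, sub_zero, zero_add, mul_one] at h4
  refine h4.congr' ?_
  filter_upwards [eventually_ge_atTop 1] with n hn
  have hpos : (0 : ℝ) < n := by exact_mod_cast hn
  rw [log_gammaRatio_succ_sub ha hn]
  field_simp
  ring

lemma tendsto_mul_gammaRatio_sub_one {a : ℝ} (ha : 0 < a) :
    Tendsto (fun n : ℕ => n * (gammaRatio a n - 1)) atTop (𝓝 (-(a * (a + 1) / 2))) := by
  have hl : Tendsto (fun n => Real.log (gammaRatio a n)) atTop (𝓝 0) := by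
    simpa using (tendsto_gammaRatio ha).log one_ne_zero
  have hnl := tendsto_mul_log_gammaRatio ha
  -- With l the logarithm, |e^l - 1 - l| ≤ l² for |l| ≤ 1, and n l² = (n l) l tends to 0.
  have herr : Tendsto (fun n : ℕ =>
      n * (gammaRatio a n - 1 - Real.log (gammaRatio a n))) atTop (𝓝 0) := by
    have hbound := (hnl.mul hl).abs
    rw [mul_zero, abs_zero] at hbound
    refine squeeze_zero_norm' ?_ hbound
    filter_upwards [hl.eventually (Metric.closedBall_mem_nhds 0 one_pos),
      eventually_ge_atTop 1] with n hn h1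
    rw [Real.dist_0_eq_abs] at hn
    have h := Real.abs_exp_sub_one_sub_id_le hn
    rw [Real.exp_log (gammaRatio_pos ha h1)] at h
    rw [norm_mul, Real.norm_eq_abs, Real.norm_eq_abs, mul_assoc, abs_mul, ← sq, abs_sq]
    gcongr
  have := hnl.add herr
  rw [add_zero] at this
  refine this.congr fun n => ?_
  ring

lemma avgOptCost_expansion {p : ℝ} (hp : 1 < p) :
    (fun N : ℕ => (N : ℝ) ^ (p / 2) * avgOptCost p N
        - Real.Gamma (1 + p / 2) / (p + 1) * (1 - 1 / (N : ℝ) * (p * (p + 2) / 8)))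
      =o[atTop] (fun N : ℕ => 1 / (N : ℝ)) := by
  rw [isLittleO_iff_tendsto']
  · have h := (((tendsto_mul_gammaRatio_sub_one (show 0 < p / 2 by linarith)).add_const
      (p * (p + 2) / 8)).const_mul (Real.Gamma (1 + p / 2) / (p + 1)))
    rw [show -(p / 2 * (p / 2 + 1) / 2) + p * (p + 2) / 8 = 0 by ring, mul_zero] at h
    refine h.congr' ?_
    filter_upwards [eventually_ge_atTop 1] with N hN
    have hpos : (0 : ℝ) < N := by exact_mod_cast hN
    rw [avgOptCost_eq hp hN, gammaRatio]
    field_simp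
    ring
  · filter_upwards [eventually_ge_atTop 1] with N hN h
    have hpos : (0 : ℝ) < N := by exact_mod_cast hN
    exact absurd h (by positivity)

lemma avgOptCost_two {N : ℕ} (hN : 1 ≤ N) : avgOptCost 2 N = 1 / (3 * ((N : ℝ) + 1)) := by
  have hg := Real.Gamma_pos_of_pos (show (0 : ℝ) < N + 1 by positivity)
  rw [avgOptCost_eq one_lt_two hN, show (1 : ℝ) + 2 / 2 = 1 + 1 by norm_num,
    show (N : ℝ) + 1 + 2 / 2 = N + 1 + 1 by norm_num, Real.Gamma_add_one one_ne_zero,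
    Real.Gamma_one, Real.Gamma_add_one (s := (N : ℝ) + 1) (by positivity)]
  field_simp
  norm_num

end RandomAssignment

theorem mainTheorem8 :
    -- optimality of the identity, and the expansion of the average optimal cost
    (∀ p : ℝ, 1 < p →
      (∀ (N : ℕ) (x y : Fin N → ℝ), StrictMono x → StrictMono y →
        (∀ i, x i ∈ Set.Icc (0 : ℝ) 1) → (∀ i, y i ∈ Set.Icc (0 : ℝ) 1) →
        ∀ π : Equiv.Perm (Fin N), π ≠ 1 →
          RandomAssignment.meanCost p x y 1 < RandomAssignment.meanCost p x y π) ∧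
      (∀ N : ℕ, 1 ≤ N →
        Integrable (fun z : (Fin N → ℝ) × (Fin N → ℝ) =>
          RandomAssignment.optMeanCost p (RandomAssignment.ordered z.1)
            (RandomAssignment.ordered z.2)) (RandomAssignment.pointsLaw N) ∧
        (N : ℝ) ^ (p / 2) * RandomAssignment.avgOptCost p N =
          ∫ s in (0 : ℝ)..1,
            ∫ z, |RandomAssignment.displacement z.1 z.2 s| ^ p ∂(RandomAssignment.pointsLaw N)) ∧
      (fun N : ℕ => (N : ℝ) ^ (p / 2) * RandomAssignment.avgOptCost p N
          - Real.Gamma (1 + p / 2) / (p + 1) * (1 - 1 / (N : ℝ) * (p * (p + 2) / 8)))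
        =o[atTop] (fun N : ℕ => 1 / (N : ℝ))) ∧
    -- the exact law of the difference of the order statistics of rank `k + 1`
    (∀ (N : ℕ) (k : Fin N),
      (RandomAssignment.pointsLaw N).map
          (fun z => RandomAssignment.ordered z.2 k - RandomAssignment.ordered z.1 k) =
        ((betaMeasure ((k : ℝ) + 1) ((N : ℝ) - k)).prod
          (betaMeasure ((k : ℝ) + 1) ((N : ℝ) - k))).map (fun q => q.2 - q.1)) ∧
    -- the exact value for `p = 2`
    (∀ N : ℕ, 1 ≤ N →
      RandomAssignment.avgOptCost 2 N = 1 / (3 * ((N : ℝ) + 1))) := by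
  refine ⟨fun p hp => ⟨?_, ?_, RandomAssignment.avgOptCost_expansion hp⟩,
    RandomAssignment.map_ordered_sub_pointsLaw, fun N hN => RandomAssignment.avgOptCost_two hN⟩
  · exact fun N x y hx hy _ _ π hπ => RandomAssignment.meanCost_id_lt hp hx hy hπ
  · exact fun N hN => ⟨RandomAssignment.integrable_optMeanCost hp N,
      RandomAssignment.avgOptCost_eq_integral_displacement hp hN⟩
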